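/- Let $\mathcal P\subset\mathbb R^n$ be an integral polytope of dimension $d$, that is, the convex hull of a nonempty finite set of points of $\mathbb Z^n$ whose affine span has dimension $d$. Let $\mathrm{vol}(\mathcal P)$ be its relative volume: the $d$-dimensional Euclidean volume of $\mathcal P$ divided by the volume of a fundamental domain of the lattice $W\cap\mathbb Z^n$, where $W$ is the linear space parallel to the affine span of $\mathcal P$ (for $d=n$ this is the usual volume). For $\alpha\in\mathbb Z^n$ write $\mathbf y^\alpha=y_1^{\alpha_1}\cdots y_n^{\alpha_n}$, and let $$Ehr_{\mathcal P}(\mathbf y;t)=\sum_{s\ge 0}\ \sum_{\alpha\in s\mathcal P\cap\mathbb Z^n}\mathbf y^\alpha t^s$$ be the multivariate Ehrhart series of $\mathcal P$. Suppose that, for a finite index set, $$Ehr_{\mathcal P}(\mathbf y;t)=\sum_i F_i(\mathbf y;t),\qquad F_i(\mathbf y;t)=\frac{L_i(\mathbf y;t)}{\prod_{k=1}^{h_i}\bigl(1-\mathbf y^{\nu_{i,k}}t^{m_{i,k}}\bigr)},$$ as an identity in the field $\mathbb C(y_1,\dots,y_n)((t))$ (which contains the rational functions in $\mathbf y,t$),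 where $0\le h_i\le d+1$, $\nu_{i,k}\in\mathbb Z^n$, $m_{i,k}\in\mathbb Z$, and each $L_i$ is a Laurent polynomial in $y_1,\dots,y_n,t$ with complex coefficients. Let $\beta\in\mathbb Z^n$ be admissible for every $F_i$, that is, for all $i$ and $k$ the integers $\beta\cdot\nu_{i,k}$ and $m_{i,k}$ are not both $0$. Then $$\mathrm{vol}(\mathcal P)=\frac1{d!}\sum_i \mathrm{Vol}_d^{\beta}F_i,$$ where $$\mathrm{Vol}_d^{\beta}F_i=\begin{cases}\displaystyle \mathop{\mathrm{CT}}_q\ \frac{L_i(1,\dots,1;1)}{\prod_{k=1}^{d+1}\bigl(m_{i,k}-(\beta\cdot\nu_{i,k})\,q\bigr)}, & h_i=d+1,\\[2ex] 0, & h_i<d+1,\end{cases}$$ and $\mathop{\mathrm{CT}}_q$ denotes the constant term (the coefficient of $q^0$) of the Laurent series expansion in $\mathbb C((q))$, i.e. at $q=0$. -/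

import Mathlib

open scoped Pointwise MeasureTheory

noncomputable section

namespace EhrhartVolume

/-! ### Integral polytopes and relative volume -/

/-- The integer vector `α`, as a point of `ℝⁿ`. -/
def intPoint {n : ℕ} (α : Fin n → ℤ) : EuclideanSpace ℝ (Fin n) :=
  WithLp.toLp 2 fun i => (α i : ℝ)

/-- A (nonempty) integral polytope in `ℝⁿ`: the convex hull of a nonempty finite set of integer
points. -/
def IsIntegralPolytope {n : ℕ} (P : Set (EuclideanSpace ℝ (Fin n))) : Prop :=
  ∃ V : Finset (Fin n → ℤ), V.Nonempty ∧ P = convexHull ℝ (intPoint '' (V : Set (Fin n → ℤ)))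

/-- The lattice `ℤⁿ` in `ℝⁿ`. -/
def integerLattice (n : ℕ) : Submodule ℤ (EuclideanSpace ℝ (Fin n)) where
  carrier := Set.range intPoint
  zero_mem' := ⟨0, by ext i; simp [intPoint]⟩
  add_mem' := by
    rintro _ _ ⟨a, rfl⟩ ⟨b, rfl⟩
    exact ⟨a + b, by ext i; simp [intPoint]⟩
  smul_mem' := by
    rintro c _ ⟨a, rfl⟩
    exact ⟨c • a, by ext i; simp [intPoint]⟩

/-- The lattice `W ∩ ℤⁿ` in the linear space `W` parallel to the affine span of `P`. -/
def directionLattice {n : ℕ} (P : Set (EuclideanSpace ℝ (Fin n))) :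
    Submodule ℤ (vectorSpan ℝ P) :=
  ZLattice.comap ℝ (integerLattice n) (vectorSpan ℝ P).subtype

/-- The relative volume of `P`: its Euclidean volume of dimension `dim P`, in units of the volume of
a fundamental domain of the lattice of integer vectors parallel to the affine span of `P`. -/
def relVol {n : ℕ} (P : Set (EuclideanSpace ℝ (Fin n))) : ℝ :=
  (μHE[Module.finrank ℝ (vectorSpan ℝ P)] P).toReal / ZLattice.covolume (directionLattice P)

/-! ### The Ehrhart series, in the field `ℂ(y₁, …, yₙ)((t))` -/

/-- The field `ℂ(y₁, …, yₙ)`. -/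
def RatFun (n : ℕ) : Type := FractionRing (MvPolynomial (Fin n) ℂ)

instance (n : ℕ) : Field (RatFun n) :=
  inferInstanceAs (Field (FractionRing (MvPolynomial (Fin n) ℂ)))

instance (n : ℕ) : Algebra (MvPolynomial (Fin n) ℂ) (RatFun n) :=
  inferInstanceAs (Algebra (MvPolynomial (Fin n) ℂ) (FractionRing (MvPolynomial (Fin n) ℂ)))

instance (n : ℕ) : IsFractionRing (MvPolynomial (Fin n) ℂ) (RatFun n) :=
  inferInstanceAs (IsFractionRing (MvPolynomial (Fin n) ℂ) (FractionRing (MvPolynomial (Fin n) ℂ)))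

/-- The Laurent monomial `y ^ ν = y₁ ^ ν₁ ⋯ yₙ ^ νₙ`. -/
def yPow {n : ℕ} (ν : Fin n → ℤ) : RatFun n :=
  ∏ i, (algebraMap (MvPolynomial (Fin n) ℂ) (RatFun n) (MvPolynomial.X i)) ^ ν i

/-- The multivariate Ehrhart series `∑ₛ ∑_{α ∈ sP ∩ ℤⁿ} y ^ α t ^ s`, a power series in `t`. -/
def ehrhartSeries {n : ℕ} (P : Set (EuclideanSpace ℝ (Fin n))) : PowerSeries (RatFun n) :=
  PowerSeries.mk fun s => ∑ᶠ α ∈ {α : Fin n → ℤ | intPoint α ∈ (s : ℝ) • P}, yPow α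

/-! ### Rational functions of the form `L / ∏ₖ (1 - y ^ νₖ t ^ mₖ)` -/

/-- Laurent polynomials in `y₁, …, yₙ, t` over `ℂ`; the exponent `(ν, m)` stands for
`y ^ ν t ^ m`. -/
abbrev LaurentPoly (n : ℕ) : Type := AddMonoidAlgebra ℂ ((Fin n → ℤ) × ℤ)

/-- The value of a Laurent polynomial at `y = (1, …, 1)`, `t = 1`. -/
def LaurentPoly.evalOne {n : ℕ} (L : LaurentPoly n) : ℂ :=
  L.coeff.sum fun _ c => c

/-- A Laurent polynomial as an element of `ℂ(y)((t))`. -/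
def LaurentPoly.toSeries {n : ℕ} (L : LaurentPoly n) : LaurentSeries (RatFun n) :=
  L.coeff.sum fun e c => HahnSeries.single e.2
    (algebraMap (MvPolynomial (Fin n) ℂ) (RatFun n) (MvPolynomial.C c) * yPow e.1)

/-- The data `L, h, ν₁, …, ν_h, m₁, …, m_h` of an expression
`L(y; t) / ∏ₖ (1 - y ^ νₖ t ^ mₖ)`. -/
structure Term (n : ℕ) where
  L : LaurentPoly n
  h : ℕ
  ν : Fin h → Fin n → ℤ
  m : Fin h → ℤ

/-- The rational function `L(y; t) / ∏ₖ (1 - y ^ νₖ t ^ mₖ)`, as an element of the field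
`ℂ(y)((t))`, of which `ℂ(y)(t)` is a subfield. -/
def Term.toSeries {n : ℕ} (F : Term n) : LaurentSeries (RatFun n) :=
  F.L.toSeries / ∏ k, (1 - HahnSeries.single (F.m k) (yPow (F.ν k)))

/-- `β` is admissible for `F` if, for every `k`, `β · νₖ` and `mₖ` are not both zero. -/
def Term.Admissible {n : ℕ} (F : Term n) (β : Fin n → ℤ) : Prop :=
  ∀ k, ¬ (β ⬝ᵥ F.ν k = 0 ∧ F.m k = 0)

/-- The `β` algebraic volume of `F`: the constant term of the Laurent series in `q` of
`L(1; 1) / ∏ₖ (mₖ - (β · νₖ) q)` if `h = d + 1`, and `0` otherwise. -/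
def Term.algVol {n : ℕ} (d : ℕ) (β : Fin n → ℤ) (F : Term n) : ℂ :=
  if F.h = d + 1 then
    HahnSeries.coeff
      ((HahnSeries.C F.L.evalOne /
        ∏ k, (HahnSeries.C (F.m k : ℂ) - HahnSeries.single 1 ((β ⬝ᵥ F.ν k : ℤ) : ℂ)) : LaurentSeries ℂ)) 0
  else 0

end EhrhartVolume

end

/-!
Substitute `y = e ^ (s q β)` and `t = e ^ (-s)`, with `q > 0` small and `s > 0`. A factor
`1 - y ^ ν t ^ m` becomes `1 - e ^ (-s (m - (β · ν) q))`, which is equivalent to `s (m - (β · ν) q)`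
as `s → 0`. Hence `s ^ (d + 1) ∑ᵢ Fᵢ` tends to
`g q = ∑ᵢ Lᵢ(1; 1) / ∏ₖ (mᵢₖ - (β · νᵢₖ) q)`, the sum over the `i` with `hᵢ = d + 1`
(`tendsto_pow_mul_evalExp_div`).

On the other side the Ehrhart series becomes a convergent series of positive numbers. If
`|β · α| ≤ C k` for the lattice points `α` of `k P`, then it lies between the values of
`E s = ∑ₖ #(k P ∩ ℤⁿ) e ^ (-s k)` at `s (1 + C q)` and at `s (1 - C q)`
(`IsIntegralPolytope.exists_hasSum_ehrhartCoeff`). Counting lattice points gives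
`#(k P ∩ ℤⁿ) ∼ vol P k ^ d` (`IsIntegralPolytope.tendsto_ncard_dilatePoints`), whence
`s ^ (d + 1) E s → d! vol P` by an Abelian theorem (`tendsto_pow_mul_tsum_exp`). So `g q` is squeezed
between `d! vol P / (1 + C q) ^ (d + 1)` and `d! vol P / (1 - C q) ^ (d + 1)`, and
`g q → d! vol P` as `q → 0`. The terms of `g` may have poles at `q = 0`, but a rational function with a limit at `0` has
this limit as the constant term of its Laurent series (`sum_coeff_zero_div_of_tendsto`).

The two sides can be compared because the identity in `ℂ(y)((t))`, once denominators are cleared,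
is an identity of Laurent polynomials in `y` for each power of `t`; these can be evaluated at
numbers and summed (`eq_sum_eval_of_toSeries_eq`).
-/

namespace EhrhartVolume

open Filter Topology Set

/-! ### Lattice points of dilated polytopes -/

/-- The lattice points of the `k`-th dilate of `P`. -/
def dilatePoints {n : ℕ} (P : Set (EuclideanSpace ℝ (Fin n))) (k : ℕ) : Set (Fin n → ℤ) :=
  {α | intPoint α ∈ (k : ℝ) • P}

theorem intPoint_injective {n : ℕ} : Function.Injective (intPoint (n := n)) := by
  intro a b h
  funext i
  have := congrArg (fun v : EuclideanSpace ℝ (Fin n) => v i) h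
  simpa [intPoint] using this

theorem intPoint_sub {n : ℕ} (a b : Fin n → ℤ) : intPoint (a - b) = intPoint a - intPoint b := by
  ext i; simp [intPoint]

theorem intPoint_add {n : ℕ} (a b : Fin n → ℤ) : intPoint (a + b) = intPoint a + intPoint b := by
  ext i; simp [intPoint]

theorem intPoint_nsmul {n : ℕ} (k : ℕ) (a : Fin n → ℤ) :
    intPoint ((k : ℤ) • a) = (k : ℝ) • intPoint a := by
  ext i; simp [intPoint]

theorem finite_intPoint_mem_of_isBounded {n : ℕ} {S : Set (EuclideanSpace ℝ (Fin n))}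
    (hS : Bornology.IsBounded S) : {α : Fin n → ℤ | intPoint α ∈ S}.Finite := by
  obtain ⟨R, hR⟩ := hS.exists_norm_le
  refine (Set.finite_Icc (fun _ : Fin n => -⌈R⌉) (fun _ => ⌈R⌉)).subset ?_
  intro α hα
  have h (i : Fin n) : |(α i : ℝ)| ≤ ⌈R⌉ := by
    have h1 := PiLp.norm_apply_le (intPoint α) i
    simp only [intPoint, Real.norm_eq_abs] at h1
    exact h1.trans ((hR _ hα).trans (Int.le_ceil R))
  constructor <;> intro i
  · exact_mod_cast (abs_le.1 (h i)).1
  · exact_mod_cast (abs_le.1 (h i)).2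

theorem IsIntegralPolytope.isCompact {n : ℕ} {P : Set (EuclideanSpace ℝ (Fin n))}
    (hP : IsIntegralPolytope P) : IsCompact P := by
  obtain ⟨V, -, rfl⟩ := hP
  exact (V.finite_toSet.image _).isCompact_convexHull (𝕜 := ℝ)

theorem IsIntegralPolytope.finite_dilatePoints {n : ℕ} {P : Set (EuclideanSpace ℝ (Fin n))}
    (hP : IsIntegralPolytope P) (k : ℕ) : (dilatePoints P k).Finite :=
  finite_intPoint_mem_of_isBounded (hP.isCompact.isBounded.smul₀ (k : ℝ))

/-- On the lattice points of the `k`-th dilate, a linear form is bounded by a multiple of `k`. -/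
theorem IsIntegralPolytope.exists_abs_dotProduct_le {n : ℕ} {P : Set (EuclideanSpace ℝ (Fin n))}
    (hP : IsIntegralPolytope P) (β : Fin n → ℤ) :
    ∃ C : ℝ, 0 ≤ C ∧ ∀ k : ℕ, ∀ α ∈ dilatePoints P k, |((β ⬝ᵥ α : ℤ) : ℝ)| ≤ C * k := by
  obtain ⟨R, hR⟩ := hP.isCompact.isBounded.exists_norm_le
  have hRn : 0 ≤ |R| := abs_nonneg R
  refine ⟨‖intPoint β‖ * |R|, by positivity, ?_⟩
  intro k α hα
  obtain ⟨x, hx, hxα⟩ := hα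
  have h1 : ((β ⬝ᵥ α : ℤ) : ℝ) = inner ℝ (intPoint α) (intPoint β) := by
    simp [intPoint, dotProduct, PiLp.inner_apply]
  rw [h1]
  refine (abs_real_inner_le_norm _ _).trans ?_
  have h2 : ‖intPoint α‖ ≤ k * |R| := by
    rw [← hxα]
    simp only [norm_smul, RCLike.norm_natCast]
    exact mul_le_mul_of_nonneg_left ((hR x hx).trans (le_abs_self R)) (by positivity)
  calc ‖intPoint α‖ * ‖intPoint β‖ ≤ (k * |R|) * ‖intPoint β‖ :=
        mul_le_mul_of_nonneg_right h2 (norm_nonneg _)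
    _ = _ := by ring

instance discreteTopology_integerLattice (n : ℕ) : DiscreteTopology (integerLattice n) := by
  refine discreteTopology_iff_isOpen_singleton_zero.mpr ⟨Metric.ball 0 1, Metric.isOpen_ball, ?_⟩
  ext ⟨x, α, rfl⟩
  simp only [mem_preimage, mem_ball_zero_iff, mem_singleton_iff]
  constructor
  · intro h
    have h0 : α = 0 := by
      funext i
      have h1 := (PiLp.norm_apply_le (intPoint α) i).trans_lt h
      simp only [intPoint, Real.norm_eq_abs] at h1
      exact Int.abs_lt_one_iff.1 (by exact_mod_cast h1)
    ext i
    simp [h0, intPoint]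
  · intro h
    have h1 := congrArg (Subtype.val) h
    simp only [ZeroMemClass.coe_zero] at h1
    rw [h1]; simp

instance discreteTopology_directionLattice {n : ℕ} (P : Set (EuclideanSpace ℝ (Fin n))) :
    DiscreteTopology (directionLattice P) :=
  ZLattice.comap_discreteTopology ℝ (integerLattice n)
    (continuous_subtype_val) (Subtype.val_injective)

/-- The vector span of an integral polytope is spanned by differences of its integral vertices. -/
theorem IsIntegralPolytope.isZLattice {n : ℕ} {P : Set (EuclideanSpace ℝ (Fin n))}
    (hP : IsIntegralPolytope P) : IsZLattice ℝ (directionLattice P) := by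
  obtain ⟨V, ⟨v₀, hv₀⟩, rfl⟩ := hP
  constructor
  set P := convexHull ℝ (intPoint '' (V : Set (Fin n → ℤ)))
  have hspan : vectorSpan ℝ P = vectorSpan ℝ (intPoint '' (V : Set (Fin n → ℤ))) := by
    rw [← direction_affineSpan, ← direction_affineSpan, affineSpan_convexHull]
  rw [eq_top_iff]
  rintro ⟨w, hw⟩ -
  have hmap : Submodule.map (vectorSpan ℝ P).subtype
      (Submodule.span ℝ (directionLattice P : Set (vectorSpan ℝ P))) = vectorSpan ℝ P := by
    refine le_antisymm (Submodule.map_subtype_le _ _) ?_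
    conv_lhs => rw [hspan, vectorSpan_def]
    rw [Submodule.span_le]
    rintro _ ⟨_, ⟨a, ha, rfl⟩, _, ⟨b, hb, rfl⟩, rfl⟩
    have hmem : intPoint a - intPoint b ∈ vectorSpan ℝ P :=
      vsub_mem_vectorSpan ℝ (subset_convexHull ℝ _ (mem_image_of_mem _ ha))
        (subset_convexHull ℝ _ (mem_image_of_mem _ hb))
    exact ⟨⟨_, hmem⟩, Submodule.subset_span ⟨a - b, intPoint_sub a b⟩, rfl⟩
  have : w ∈ Submodule.map (vectorSpan ℝ P).subtype
      (Submodule.span ℝ (directionLattice P : Set (vectorSpan ℝ P))) := by rw [hmap]; exact hw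
  obtain ⟨w', hw', rfl⟩ := this
  exact hw'

/-- The number of lattice points of the `k`-th dilate grows like the relative volume of `P`
times `k ^ dim P`. -/
theorem IsIntegralPolytope.tendsto_ncard_dilatePoints {n d : ℕ}
    {P : Set (EuclideanSpace ℝ (Fin n))} (hP : IsIntegralPolytope P)
    (hd : Module.finrank ℝ (vectorSpan ℝ P) = d) :
    Tendsto (fun k : ℕ => ((dilatePoints P k).ncard : ℝ) / (k : ℝ) ^ d) atTop (𝓝 (relVol P)) := by
  have := hP.isZLattice
  have hcpt := hP.isCompact
  have hconv : Convex ℝ P := by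
    obtain ⟨V, -, rfl⟩ := hP
    exact convex_convexHull ℝ _
  obtain ⟨v₀, hv₀⟩ : ∃ v₀, intPoint v₀ ∈ P := by
    obtain ⟨V, ⟨v₀, hv₀⟩, rfl⟩ := hP
    exact ⟨v₀, subset_convexHull ℝ _ (mem_image_of_mem _ hv₀)⟩
  -- `P` translated by an integral vertex, inside its vector span
  let f : vectorSpan ℝ P → EuclideanSpace ℝ (Fin n) := fun w => intPoint v₀ + w
  have hf : Isometry f := (isometry_add_left (intPoint v₀)).comp isometry_subtype_coe
  let S : Set (vectorSpan ℝ P) := f ⁻¹' P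
  have hPf : P ⊆ range f := fun x hx =>
    ⟨⟨x - intPoint v₀, vsub_mem_vectorSpan ℝ hx hv₀⟩, by simp [f]⟩
  have hSb : Bornology.IsBounded S := hf.antilipschitz.isBounded_preimage hcpt.isBounded
  have hSc : IsClosed S := hcpt.isClosed.preimage hf.continuous
  have hSconv : Convex ℝ S := by
    have : S = (vectorSpan ℝ P).subtype ⁻¹' ((fun z => intPoint v₀ + z) ⁻¹' P) := rfl
    rw [this]
    exact (hconv.translate_preimage_right _).linear_preimage _
  have hvol : MeasureTheory.volume.real S / ZLattice.covolume (directionLattice P) = relVol P := by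
    rw [relVol, MeasureTheory.measureReal_def,
      ← InnerProductSpace.euclideanHausdorffMeasure_eq_volume,
      hf.euclideanHausdorffMeasure_preimage, inter_eq_left.2 hPf]
  rw [← hvol, ← hd]
  refine (ZLattice.covolume.tendsto_card_div_pow' (directionLattice P) hSb hSc.measurableSet
    (hSconv.addHaar_frontier _)).congr' ?_
  filter_upwards [eventually_gt_atTop 0] with k hk
  have hk' : (k : ℝ) ≠ 0 := by positivity
  congr 2
  rw [Nat.card_coe_set_eq, ← ncard_image_of_injective _ intPoint_injective,
    ← ncard_image_of_injective _ ((smul_right_injective _ hk').comp hf.injective)]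
  congr 1
  ext x
  constructor
  · rintro ⟨w, ⟨hw, hwL⟩, rfl⟩
    obtain ⟨α, hα⟩ := (mem_inv_smul_set_iff₀ hk' _ _).1 hwL
    have hx : intPoint (α + (k : ℤ) • v₀) = (k : ℝ) • f w := by
      rw [intPoint_add, intPoint_nsmul, hα, smul_add, add_comm]; rfl
    exact ⟨_, ⟨f w, hw, hx.symm⟩, hx⟩
  · rintro ⟨α, ⟨x, hxP, hx⟩, rfl⟩
    obtain ⟨w, rfl⟩ := hPf hxP
    refine ⟨w, ⟨hxP, (mem_inv_smul_set_iff₀ hk' _ _).2 ⟨α - (k : ℤ) • v₀, ?_⟩⟩, hx⟩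
    rw [intPoint_sub, intPoint_nsmul, ← hx]
    simp [f]

/-! ### An Abelian theorem -/

theorem tendsto_div_choose_of_tendsto_div_pow {a : ℕ → ℝ} {V : ℝ} {d : ℕ}
    (ha : Tendsto (fun k : ℕ => a k / (k : ℝ) ^ d) atTop (𝓝 V)) :
    Tendsto (fun k : ℕ => a k / ((k + d).choose d : ℝ)) atTop (𝓝 (V * d.factorial)) := by
  have h1 : Tendsto (fun k : ℕ => ((k + d : ℕ) : ℝ) ^ d / d.factorial / ((k + d).choose d : ℝ)) atTop
      (𝓝 1) := by
    have h := (isEquivalent_choose d).symm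
    rw [Asymptotics.isEquivalent_iff_tendsto_one] at h
    · exact h.comp (tendsto_add_atTop_nat d)
    · filter_upwards [eventually_ge_atTop d] with k hk
      exact_mod_cast (Nat.choose_pos hk).ne'
  have h2 : Tendsto (fun k : ℕ => (k : ℝ) / ((k + d : ℕ) : ℝ)) atTop (𝓝 1) := by
    simpa using tendsto_natCast_div_add_atTop (d : ℝ)
  have h3 := ((ha.mul (h2.pow d)).mul h1).mul_const (d.factorial : ℝ)
  simp only [one_pow, mul_one] at h3
  refine h3.congr' ?_
  filter_upwards [eventually_gt_atTop 0] with k hk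
  have e1 : (k : ℝ) ≠ 0 := by positivity
  have e2 : ((k + d : ℕ) : ℝ) ≠ 0 := by positivity
  have e3 : ((k + d).choose d : ℝ) ≠ 0 := by
    exact_mod_cast (Nat.choose_pos (Nat.le_add_left d k)).ne'
  have e4 : (d.factorial : ℝ) ≠ 0 := by positivity
  rw [div_pow]
  field_simp

theorem summable_mul_pow_of_tendsto_div_pow {a : ℕ → ℝ} {V : ℝ} {d : ℕ}
    (ha : Tendsto (fun k : ℕ => a k / (k : ℝ) ^ d) atTop (𝓝 V)) {x : ℝ} (hx0 : 0 ≤ x)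
    (hx : x < 1) : Summable fun k => a k * x ^ k := by
  have hO : a =O[atTop] fun k : ℕ => (k : ℝ) ^ d := by
    refine Asymptotics.isBigO_of_div_tendsto_nhds ?_ V ha
    filter_upwards [eventually_gt_atTop 0] with k hk h
    exact absurd h (by positivity)
  have hs : Summable fun k : ℕ => ((k : ℝ) ^ d) * x ^ k :=
    summable_pow_mul_geometric_of_norm_lt_one d (by rwa [Real.norm_of_nonneg hx0])
  exact summable_of_isBigO_nat hs (hO.mul (Asymptotics.isBigO_refl _ _))

/-- If `a k ∼ V k ^ d`, then `∑ₖ a k x ^ k ∼ V d! / (1 - x) ^ (d + 1)` as `x → 1-`, by comparison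
with `∑ₖ (k + d).choose d * x ^ k = (1 - x) ^ (-(d + 1))`. -/
theorem tendsto_one_sub_pow_mul_tsum {a : ℕ → ℝ} {V : ℝ} {d : ℕ}
    (ha : Tendsto (fun k : ℕ => a k / (k : ℝ) ^ d) atTop (𝓝 V)) :
    Tendsto (fun x : ℝ => (1 - x) ^ (d + 1) * ∑' k, a k * x ^ k) (𝓝[<] 1)
      (𝓝 (V * d.factorial)) := by
  set c := V * d.factorial
  set b : ℕ → ℝ := fun k => ((k + d).choose d : ℝ) with hb
  have hbpos (k : ℕ) : 0 < b k :=
    Nat.cast_pos.2 (Nat.choose_pos (Nat.le_add_left d k))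
  have hlim : Tendsto (fun k => a k / b k) atTop (𝓝 c) := tendsto_div_choose_of_tendsto_div_pow ha
  rw [Metric.tendsto_nhds]
  intro ε hε
  obtain ⟨K, hK⟩ := (Metric.tendsto_atTop.1 hlim) (ε / 2) (by positivity)
  -- beyond `K` the error is at most `ε / 2 * b k`; the finitely many terms before `K` contribute at
  -- most `M`, which the factor `(1 - x) ^ (d + 1)` makes negligible
  set M := ∑ k ∈ Finset.range K, |a k - c * b k|
  have hM : ∀ᶠ x in 𝓝[<] (1 : ℝ), (1 - x) ^ (d + 1) * M < ε / 2 := by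
    have : Tendsto (fun x : ℝ => (1 - x) ^ (d + 1) * M) (𝓝[<] 1) (𝓝 0) := by
      have h : ContinuousAt (fun x : ℝ => (1 - x) ^ (d + 1) * M) 1 := by fun_prop
      have h' := h.tendsto
      simp only [sub_self, ne_eq, Nat.add_eq_zero_iff, one_ne_zero, and_false, not_false_eq_true,
        zero_pow, zero_mul] at h'
      exact h'.mono_left nhdsWithin_le_nhds
    exact this.eventually (gt_mem_nhds (by positivity))
  filter_upwards [hM, Ioo_mem_nhdsLT (zero_lt_one' ℝ)] with x hxM hx
  have hxn : ‖x‖ < 1 := by rw [Real.norm_of_nonneg hx.1.le]; exact hx.2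
  have hsb : HasSum (fun k => b k * x ^ k) (1 / (1 - x) ^ (d + 1)) :=
    hasSum_choose_mul_geometric_of_norm_lt_one d hxn
  have hsa := summable_mul_pow_of_tendsto_div_pow ha hx.1.le hx.2
  have hp : 0 < (1 - x) ^ (d + 1) := pow_pos (by linarith [hx.2]) _
  have hse : HasSum (fun k => (a k - c * b k) * x ^ k)
      ((∑' k, a k * x ^ k) - c * (1 / (1 - x) ^ (d + 1))) := by
    refine (hsa.hasSum.sub (hsb.mul_left c)).congr_fun ?_
    intro k; ring
  have hfin : HasSum (fun k => if k ∈ Finset.range K then |a k - c * b k| else 0) M := by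
    have h := hasSum_sum_of_ne_finset_zero (L := .unconditional ℕ) (s := Finset.range K)
      (f := fun k => if k ∈ Finset.range K then |a k - c * b k| else 0) fun k hk => if_neg hk
    rwa [Finset.sum_congr rfl fun k hk => if_pos hk] at h
  have hbd : |(∑' k, a k * x ^ k) - c * (1 / (1 - x) ^ (d + 1))| ≤
      ε / 2 * (1 / (1 - x) ^ (d + 1)) + M := by
    refine hse.norm_le_of_bounded ((hsb.mul_left (ε / 2)).add hfin) fun k => ?_
    rw [norm_mul, norm_pow, Real.norm_eq_abs, Real.norm_of_nonneg hx.1.le]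
    have hxk : 0 ≤ x ^ k := pow_nonneg hx.1.le k
    have hxk1 : x ^ k ≤ 1 := pow_le_one₀ hx.1.le hx.2.le
    split_ifs with hk
    · have h1 : |a k - c * b k| * x ^ k ≤ |a k - c * b k| :=
        mul_le_of_le_one_right (abs_nonneg _) hxk1
      have h2 : 0 ≤ ε / 2 * (b k * x ^ k) := by have := hbpos k; positivity
      linarith
    · have h1 := hK k (by simpa using hk)
      rw [Real.dist_eq] at h1
      have h2 : a k - c * b k = (a k / b k - c) * b k := by
        have := (hbpos k).ne'
        field_simp
      rw [h2, abs_mul, abs_of_pos (hbpos k), add_zero, ← mul_assoc]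
      exact mul_le_mul_of_nonneg_right
        (mul_le_mul_of_nonneg_right h1.le (hbpos k).le) hxk
  rw [Real.dist_eq]
  have h3 : (1 - x) ^ (d + 1) * (∑' k, a k * x ^ k) - c =
      (1 - x) ^ (d + 1) * ((∑' k, a k * x ^ k) - c * (1 / (1 - x) ^ (d + 1))) := by
    field_simp
  rw [h3, abs_mul, abs_of_pos hp]
  calc _ ≤ (1 - x) ^ (d + 1) * (ε / 2 * (1 / (1 - x) ^ (d + 1)) + M) :=
        mul_le_mul_of_nonneg_left hbd hp.le
    _ = ε / 2 + (1 - x) ^ (d + 1) * M := by field_simp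
    _ < ε := by linarith

theorem tendsto_one_sub_exp_div (a : ℝ) :
    Tendsto (fun s : ℝ => (1 - Real.exp (-(s * a))) / s) (𝓝[>] 0) (𝓝 a) := by
  have h : HasDerivAt (fun s : ℝ => 1 - Real.exp (-(s * a))) a 0 := by
    have h1 : HasDerivAt (fun s : ℝ => -(s * a)) (-(1 * a)) 0 :=
      ((hasDerivAt_id (0 : ℝ)).mul_const a).neg
    have h2 := (h1.exp).const_sub 1
    simpa using h2
  have h3 := h.tendsto_slope_zero_right
  refine h3.congr fun s => ?_
  simp [div_eq_inv_mul]

/-- If `a k ∼ V k ^ d`, then `∑ₖ a k e ^ (-s l k) ∼ V d! / (s l) ^ (d + 1)` as `s → 0+`. -/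
theorem tendsto_pow_mul_tsum_exp {a : ℕ → ℝ} {V : ℝ} {d : ℕ}
    (ha : Tendsto (fun k : ℕ => a k / (k : ℝ) ^ d) atTop (𝓝 V)) {l : ℝ} (hl : 0 < l) :
    Tendsto (fun s : ℝ => s ^ (d + 1) * ∑' k, a k * Real.exp (-(s * l)) ^ k) (𝓝[>] 0)
      (𝓝 (V * d.factorial / l ^ (d + 1))) := by
  have hx : Tendsto (fun s : ℝ => Real.exp (-(s * l))) (𝓝[>] 0) (𝓝[<] 1) := by
    refine tendsto_nhdsWithin_iff.2 ⟨?_, ?_⟩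
    · have h : ContinuousAt (fun s : ℝ => Real.exp (-(s * l))) 0 := by fun_prop
      have h' := h.tendsto
      simp only [zero_mul, neg_zero, Real.exp_zero] at h'
      exact h'.mono_left nhdsWithin_le_nhds
    · filter_upwards [self_mem_nhdsWithin] with s hs
      have : 0 < s * l := mul_pos hs hl
      simpa using this
  have h1 := (tendsto_one_sub_pow_mul_tsum ha).comp hx
  have h2 := h1.div ((tendsto_one_sub_exp_div l).pow (d + 1)) (by positivity)
  refine h2.congr' ?_
  filter_upwards [self_mem_nhdsWithin] with s (hs : 0 < s)
  have h3 : 1 - Real.exp (-(s * l)) ≠ 0 := by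
    have : Real.exp (-(s * l)) < 1 := by
      have : 0 < s * l := mul_pos hs hl
      simpa using this
    linarith
  simp only [Pi.div_apply, Function.comp_apply, div_pow]
  field_simp

/-! ### Laurent polynomials inside `ℂ(y)` and `ℂ(y)((t))` -/

theorem yPow_zero {n : ℕ} : yPow (0 : Fin n → ℤ) = 1 := by simp [yPow]

theorem yPow_add {n : ℕ} (a b : Fin n → ℤ) : yPow (a + b) = yPow a * yPow b := by
  have hX (i : Fin n) : algebraMap (MvPolynomial (Fin n) ℂ) (RatFun n) (MvPolynomial.X i) ≠ 0 :=
    (map_ne_zero_iff _ (IsFractionRing.injective _ _)).2 (MvPolynomial.X_ne_zero i)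
  simp only [yPow, Pi.add_apply, zpow_add₀ (hX _), Finset.prod_mul_distrib]

theorem algebraMap_monomial {n : ℕ} (s : Fin n →₀ ℕ) (c : ℂ) :
    algebraMap (MvPolynomial (Fin n) ℂ) (RatFun n) (MvPolynomial.monomial s c) =
      algebraMap (MvPolynomial (Fin n) ℂ) (RatFun n) (MvPolynomial.C c) *
        yPow (fun i => (s i : ℤ)) := by
  rw [MvPolynomial.monomial_eq, map_mul, Finsupp.prod_fintype _ _ (by simp), map_prod]
  simp [yPow]

theorem liftNCRingHom_eq_sum {k G R : Type*} [Semiring k] [AddMonoid G] [Semiring R]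
    (f : k →+* R) (g : Multiplicative G →* R) (h) (L : AddMonoidAlgebra k G) :
    AddMonoidAlgebra.liftNCRingHom f g h L =
      L.coeff.sum fun e c => f c * g (Multiplicative.ofAdd e) := by
  conv_lhs => rw [← AddMonoidAlgebra.sum_coeff_single L]
  simp only [map_finsuppSum, AddMonoidAlgebra.liftNCRingHom_single]

/-- The inclusion of the Laurent polynomials in `y₁, …, yₙ` into `ℂ(y)`. -/
noncomputable def laurentToRatFun (n : ℕ) : AddMonoidAlgebra ℂ (Fin n → ℤ) →+* RatFun n :=
  AddMonoidAlgebra.liftNCRingHom ((algebraMap (MvPolynomial (Fin n) ℂ) (RatFun n)).comp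
    MvPolynomial.C)
    { toFun := fun ν => yPow ν.toAdd
      map_one' := yPow_zero
      map_mul' := fun _ _ => yPow_add _ _ } fun _ _ => Commute.all _ _

theorem laurentToRatFun_single {n : ℕ} (ν : Fin n → ℤ) (c : ℂ) :
    laurentToRatFun n (AddMonoidAlgebra.single ν c) =
      algebraMap (MvPolynomial (Fin n) ℂ) (RatFun n) (MvPolynomial.C c) * yPow ν :=
  AddMonoidAlgebra.liftNCRingHom_single _ _ _ _ _

/-- A Laurent polynomial times a monomial with large exponents is a polynomial. -/
theorem laurentToRatFun_injective (n : ℕ) : Function.Injective (laurentToRatFun n) := by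
  rw [injective_iff_map_eq_zero]
  intro f hf
  -- shifting by `γ` makes every exponent of `f` nonnegative
  let γ : Fin n → ℤ := fun i => ∑ α ∈ f.coeff.support, |α i|
  have hγ : ∀ α ∈ f.coeff.support, ∀ i, 0 ≤ (α + γ) i := by
    intro α hα i
    have h1 : |α i| ≤ γ i :=
      Finset.single_le_sum (f := fun α : Fin n → ℤ => |α i|) (fun _ _ => abs_nonneg _) hα
    have h2 := neg_abs_le (α i)
    simp only [Pi.add_apply]
    linarith
  let e : (Fin n → ℤ) → (Fin n →₀ ℕ) := fun α => Finsupp.equivFunOnFinite.symm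
    fun i => ((α + γ) i).toNat
  have he : ∀ α ∈ f.coeff.support, (fun i => ((e α i : ℕ) : ℤ)) = α + γ := by
    intro α hα
    funext i
    exact Int.toNat_of_nonneg (hγ α hα i)
  let p : MvPolynomial (Fin n) ℂ :=
    ∑ α ∈ f.coeff.support, MvPolynomial.monomial (e α) (f.coeff α)
  have hp : algebraMap (MvPolynomial (Fin n) ℂ) (RatFun n) p = laurentToRatFun n f * yPow γ := by
    conv_rhs => rw [← AddMonoidAlgebra.sum_coeff_single f]
    simp only [p, map_sum, algebraMap_monomial, Finsupp.sum, Finset.sum_mul,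
      laurentToRatFun_single, mul_assoc, ← yPow_add]
    exact Finset.sum_congr rfl fun α hα => by rw [he α hα]
  have hp0 : p = 0 := by
    rw [hf, zero_mul] at hp
    exact (map_eq_zero_iff _ (IsFractionRing.injective _ _)).1 hp
  ext α
  by_contra hne
  have hα : α ∈ f.coeff.support := Finsupp.mem_support_iff.2 hne
  have hcoeff : MvPolynomial.coeff (e α) p = f.coeff α := by
    simp only [p, MvPolynomial.coeff_sum, MvPolynomial.coeff_monomial]
    rw [Finset.sum_eq_single_of_mem α hα, if_pos rfl]
    intro α' hα' hne'
    refine if_neg fun h => hne' ?_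
    have h1 := he α hα
    rw [← h, he α' hα'] at h1
    exact add_right_cancel h1
  rw [hp0, MvPolynomial.coeff_zero] at hcoeff
  exact hne hcoeff.symm

/-- `LaurentPoly.toSeries`, as a ring homomorphism. -/
noncomputable def laurentToSeries (n : ℕ) : LaurentPoly n →+* LaurentSeries (RatFun n) :=
  AddMonoidAlgebra.liftNCRingHom (HahnSeries.C.comp
    ((algebraMap (MvPolynomial (Fin n) ℂ) (RatFun n)).comp MvPolynomial.C))
    { toFun := fun e => HahnSeries.single e.toAdd.2 (yPow e.toAdd.1)
      map_one' := by rw [toAdd_one, Prod.fst_zero, Prod.snd_zero, yPow_zero]; rfl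
      map_mul' := fun _ _ => by
        rw [HahnSeries.single_mul_single, toAdd_mul, Prod.fst_add, Prod.snd_add, yPow_add] }
    fun _ _ => Commute.all _ _

theorem laurentToSeries_apply {n : ℕ} (L : LaurentPoly n) : laurentToSeries n L = L.toSeries := by
  rw [laurentToSeries, liftNCRingHom_eq_sum, LaurentPoly.toSeries]
  refine Finsupp.sum_congr fun e _ => ?_
  simp [HahnSeries.C_apply, HahnSeries.single_mul_single]

theorem laurentToSeries_single {n : ℕ} (ν : Fin n → ℤ) (m : ℤ) :
    laurentToSeries n (AddMonoidAlgebra.single (ν, m) 1) = HahnSeries.single m (yPow ν) := by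
  rw [laurentToSeries, AddMonoidAlgebra.liftNCRingHom_single]
  simp

theorem one_sub_single_ne_zero {n : ℕ} {ν : Fin n → ℤ} {m : ℤ} (h : ¬ (ν = 0 ∧ m = 0)) :
    (1 - HahnSeries.single m (yPow ν) : LaurentSeries (RatFun n)) ≠ 0 := by
  rw [sub_ne_zero]
  intro heq
  have h0 := congrArg (fun x => HahnSeries.coeff x 0) heq
  by_cases hm : m = 0
  · subst hm
    simp only [HahnSeries.coeff_one, if_true, HahnSeries.coeff_single_same] at h0
    refine h ⟨?_, rfl⟩
    have h1 : laurentToRatFun n (AddMonoidAlgebra.single 0 1) =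
        laurentToRatFun n (AddMonoidAlgebra.single ν 1) := by
      simp [laurentToRatFun_single, ← h0, yPow_zero]
    have h2 := laurentToRatFun_injective n h1
    rw [AddMonoidAlgebra.single_left_inj one_ne_zero] at h2
    exact h2.symm
  · simp [HahnSeries.coeff_single_of_ne (Ne.symm hm)] at h0

/-- Multiplication by a Laurent polynomial is a finite convolution on coefficients. -/
theorem coeff_toSeries_mul {n : ℕ} (L : LaurentPoly n) {x : LaurentSeries (RatFun n)}
    {c : ℤ → AddMonoidAlgebra ℂ (Fin n → ℤ)} (hc : ∀ k, x.coeff k = laurentToRatFun n (c k))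
    (j : ℤ) : (L.toSeries * x).coeff j = laurentToRatFun n
      (L.coeff.sum fun e a => AddMonoidAlgebra.single e.1 a * c (j - e.2)) := by
  rw [LaurentPoly.toSeries, Finsupp.sum, Finset.sum_mul, HahnSeries.coeff_sum, Finsupp.sum, map_sum]
  refine Finset.sum_congr rfl fun e _ => ?_
  rw [HahnSeries.coeff_single_mul, hc, map_mul, laurentToRatFun_single]

/-! ### Evaluation at numbers -/

/-- The value of a Laurent polynomial in `y` at the point given by a character of `ℤⁿ`. -/
noncomputable def evalChar {n : ℕ} (w : Multiplicative (Fin n → ℤ) →* ℂ) :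
    AddMonoidAlgebra ℂ (Fin n → ℤ) →+* ℂ :=
  AddMonoidAlgebra.liftNCRingHom (RingHom.id ℂ) w fun _ _ => Commute.all _ _

/-- The value of a Laurent polynomial in `y, t` at the point given by a character of `ℤⁿ` and
a nonzero number. -/
noncomputable def evalCharUnit {n : ℕ} (w : Multiplicative (Fin n → ℤ) →* ℂ) (τ : ℂˣ) :
    LaurentPoly n →+* ℂ :=
  AddMonoidAlgebra.liftNCRingHom (RingHom.id ℂ)
    { toFun := fun e => w (.ofAdd e.toAdd.1) * (τ : ℂ) ^ e.toAdd.2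
      map_one' := by simp
      map_mul' := fun a b => by
        rw [toAdd_mul, Prod.fst_add, Prod.snd_add, ofAdd_add, map_mul, zpow_add₀ τ.ne_zero]
        ring } fun _ _ => Commute.all _ _

theorem evalCharUnit_apply {n : ℕ} (w : Multiplicative (Fin n → ℤ) →* ℂ) (τ : ℂˣ)
    (L : LaurentPoly n) : evalCharUnit w τ L =
      L.coeff.sum fun e a => a * (w (.ofAdd e.1) * (τ : ℂ) ^ e.2) :=
  liftNCRingHom_eq_sum _ _ _ _

theorem evalChar_single {n : ℕ} (w : Multiplicative (Fin n → ℤ) →* ℂ) (ν : Fin n → ℤ) (a : ℂ) :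
    evalChar w (AddMonoidAlgebra.single ν a) = a * w (.ofAdd ν) :=
  AddMonoidAlgebra.liftNCRingHom_single _ _ _ _ _

theorem evalCharUnit_single {n : ℕ} (w : Multiplicative (Fin n → ℤ) →* ℂ) (τ : ℂˣ)
    (e : (Fin n → ℤ) × ℤ) (a : ℂ) :
    evalCharUnit w τ (AddMonoidAlgebra.single e a) = a * (w (.ofAdd e.1) * (τ : ℂ) ^ e.2) :=
  AddMonoidAlgebra.liftNCRingHom_single _ _ _ _ _

theorem hasSum_evalChar_convolution {n : ℕ} (w : Multiplicative (Fin n → ℤ) →* ℂ) (τ : ℂˣ)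
    (L : LaurentPoly n) {c : ℤ → AddMonoidAlgebra ℂ (Fin n → ℤ)} {S : ℂ}
    (hS : HasSum (fun k => evalChar w (c k) * (τ : ℂ) ^ k) S) :
    HasSum (fun j => evalChar w
      (L.coeff.sum fun e a => AddMonoidAlgebra.single e.1 a * c (j - e.2)) * (τ : ℂ) ^ j)
      (evalCharUnit w τ L * S) := by
  simp only [evalCharUnit_apply, Finsupp.sum, Finset.sum_mul, map_sum, map_mul, evalChar_single]
  refine hasSum_sum fun e _ => ?_
  have h := ((Equiv.subRight e.2).hasSum_iff.2 hS).mul_left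
    (L.coeff e * (w (.ofAdd e.1) * (τ : ℂ) ^ e.2))
  refine h.congr_fun fun j => ?_
  simp only [Function.comp_apply, Equiv.subRight_apply, zpow_sub₀ τ.ne_zero]
  have := zpow_ne_zero e.2 τ.ne_zero
  field_simp

theorem prod_mul_sum_div {ι K : Type*} [Fintype ι] [DecidableEq ι] [Field K] (l D : ι → K)
    (hD : ∀ i, D i ≠ 0) :
    (∏ i, D i) * ∑ i, l i / D i = ∑ i, l i * ∏ j ∈ Finset.univ.erase i, D j := by
  rw [Finset.mul_sum]
  refine Finset.sum_congr rfl fun i _ => ?_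
  rw [← Finset.mul_prod_erase _ _ (Finset.mem_univ i)]
  have := hD i
  field_simp

/-- The denominator of a `Term`, as a Laurent polynomial. -/
noncomputable def Term.denom {n : ℕ} (F : Term n) : LaurentPoly n :=
  ∏ k, (1 - AddMonoidAlgebra.single (F.ν k, F.m k) 1)

theorem Term.toSeries_eq_div {n : ℕ} (F : Term n) :
    F.toSeries = laurentToSeries n F.L / laurentToSeries n F.denom := by
  simp only [Term.toSeries, Term.denom, ← laurentToSeries_apply, map_prod, map_sub, map_one,
    laurentToSeries_single]

theorem Term.Admissible.laurentToSeries_denom_ne_zero {n : ℕ} {F : Term n} {β : Fin n → ℤ}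
    (h : F.Admissible β) : laurentToSeries n F.denom ≠ 0 := by
  simp only [Term.denom, map_prod, map_sub, map_one, laurentToSeries_single]
  refine Finset.prod_ne_zero_iff.2 fun k _ => one_sub_single_ne_zero ?_
  rintro ⟨h1, h2⟩
  exact h k ⟨by simp [h1], h2⟩

/-- An identity in `ℂ(y)((t))` between a Laurent series with Laurent polynomial coefficients and a
sum of rational functions holds numerically at each point where the series converges absolutely
and no denominator vanishes. -/
theorem eq_sum_eval_of_toSeries_eq {n : ℕ} {ι : Type*} [Fintype ι] {F : ι → Term n}
    {β : Fin n → ℤ} (hβ : ∀ i, (F i).Admissible β) {x : LaurentSeries (RatFun n)}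
    (hx : x = ∑ i, (F i).toSeries) {c : ℤ → AddMonoidAlgebra ℂ (Fin n → ℤ)}
    (hc : ∀ k, x.coeff k = laurentToRatFun n (c k)) (w : Multiplicative (Fin n → ℤ) →* ℂ) (τ : ℂˣ)
    {S : ℂ} (hS : HasSum (fun k => evalChar w (c k) * (τ : ℂ) ^ k) S)
    (hD : ∀ i, evalCharUnit w τ (F i).denom ≠ 0) :
    S = ∑ i, evalCharUnit w τ (F i).L / evalCharUnit w τ (F i).denom := by
  classical
  let D : LaurentPoly n := ∏ i, (F i).denom
  let N : LaurentPoly n := ∑ i, (F i).L * ∏ j ∈ Finset.univ.erase i, (F j).denom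
  have hDN : D.toSeries * x = N.toSeries * 1 := by
    rw [hx, mul_one, ← laurentToSeries_apply, ← laurentToSeries_apply]
    simp only [Term.toSeries_eq_div, D, N, map_prod, map_sum, map_mul]
    exact prod_mul_sum_div _ _ fun i => (hβ i).laurentToSeries_denom_ne_zero
  -- the coefficients of the series `1`, so that `N = N * 1` is treated like `D * x`
  let δ : ℤ → AddMonoidAlgebra ℂ (Fin n → ℤ) := fun k => if k = 0 then 1 else 0
  have hδ (k : ℤ) : (1 : LaurentSeries (RatFun n)).coeff k = laurentToRatFun n (δ k) := by
    simp only [HahnSeries.coeff_one, δ]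
    split_ifs <;> simp
  have hδS : HasSum (fun k => evalChar w (δ k) * (τ : ℂ) ^ k) 1 := by
    convert hasSum_ite_eq (0 : ℤ) (1 : ℂ) using 2 with k
    simp only [δ]
    split_ifs with hk <;> simp [hk]
  have hlevel (j : ℤ) :
      (D.coeff.sum fun e a => AddMonoidAlgebra.single e.1 a * c (j - e.2)) =
        N.coeff.sum fun e a => AddMonoidAlgebra.single e.1 a * δ (j - e.2) :=
    laurentToRatFun_injective n (by
      rw [← coeff_toSeries_mul D hc j, ← coeff_toSeries_mul N hδ j, hDN])
  have h1 := hasSum_evalChar_convolution w τ D hS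
  have h2 := hasSum_evalChar_convolution w τ N hδS
  simp only [hlevel] at h1
  have h3 := h1.unique h2
  have hD0 : evalCharUnit w τ D ≠ 0 := by
    simp only [D, map_prod]
    exact Finset.prod_ne_zero_iff.2 fun i _ => hD i
  refine mul_left_cancel₀ hD0 ?_
  rw [h3, mul_one]
  simp only [D, N, map_prod, map_sum, map_mul]
  exact (prod_mul_sum_div _ _ hD).symm

/-! ### Constant terms of rational functions in `q` -/

/-- The inclusion of `ℂ[q]` into `ℂ((q))`. -/
noncomputable def polyToLaurent : Polynomial ℂ →+* LaurentSeries ℂ :=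
  (HahnSeries.ofPowerSeries ℤ ℂ).comp Polynomial.coeToPowerSeries.ringHom

theorem polyToLaurent_apply (p : Polynomial ℂ) :
    polyToLaurent p = HahnSeries.ofPowerSeries ℤ ℂ (p : PowerSeries ℂ) := rfl

theorem polyToLaurent_C (a : ℂ) : polyToLaurent (.C a) = HahnSeries.C a := by
  rw [polyToLaurent_apply, Polynomial.coe_C, HahnSeries.ofPowerSeries_C]

theorem polyToLaurent_C_mul_X (a : ℂ) :
    polyToLaurent (.C a * .X) = HahnSeries.single 1 a := by
  rw [map_mul, polyToLaurent_C, polyToLaurent_apply, Polynomial.coe_X, HahnSeries.ofPowerSeries_X,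
    HahnSeries.C_apply, HahnSeries.single_mul_single, zero_add, mul_one]

theorem polyToLaurent_injective : Function.Injective polyToLaurent :=
  HahnSeries.ofPowerSeries_injective.comp (Polynomial.coe_injective ℂ)

theorem exists_eq_X_pow_mul {p : Polynomial ℂ} (hp : p ≠ 0) :
    ∃ (a : ℕ) (r : Polynomial ℂ), p = .X ^ a * r ∧ r.eval 0 ≠ 0 := by
  obtain ⟨r, h1, h2⟩ := Polynomial.exists_eq_pow_rootMultiplicity_mul_and_not_dvd p hp 0
  refine ⟨_, r, by simpa using h1, ?_⟩
  rwa [Polynomial.dvd_iff_isRoot] at h2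

theorem tendsto_eval_nhdsGT_zero (p : Polynomial ℂ) :
    Tendsto (fun q : ℝ => p.eval (q : ℂ)) (𝓝[>] 0) (𝓝 (p.eval 0)) := by
  have h : Continuous fun q : ℝ => p.eval (q : ℂ) := p.continuous.comp Complex.continuous_ofReal
  have h1 := h.tendsto 0
  rw [Complex.ofReal_zero] at h1
  exact h1.mono_left nhdsWithin_le_nhds

theorem eventually_eval_ne_zero {p : Polynomial ℂ} (hp : p ≠ 0) :
    ∀ᶠ q : ℝ in 𝓝[>] 0, p.eval (q : ℂ) ≠ 0 := by
  obtain ⟨a, r, rfl, hr⟩ := exists_eq_X_pow_mul hp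
  filter_upwards [(tendsto_eval_nhdsGT_zero r).eventually_ne hr, self_mem_nhdsWithin] with q h1 h2
  simp only [Polynomial.eval_mul, Polynomial.eval_pow, Polynomial.eval_X]
  have : (q : ℂ) ≠ 0 := Complex.ofReal_ne_zero.2 (ne_of_gt h2)
  positivity

/-- A rational function that tends to `0` at `0` has a zero there, so that its Laurent series has
no constant term. -/
theorem coeff_zero_div_eq_zero_of_tendsto_zero {p r : Polynomial ℂ} (hr : r ≠ 0)
    (h : Tendsto (fun q : ℝ => p.eval (q : ℂ) / r.eval (q : ℂ)) (𝓝[>] 0) (𝓝 0)) :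
    (polyToLaurent p / polyToLaurent r).coeff 0 = 0 := by
  by_cases hp : p = 0
  · simp [hp]
  obtain ⟨a, p', rfl, hp'⟩ := exists_eq_X_pow_mul hp
  obtain ⟨b, r', rfl, hr'⟩ := exists_eq_X_pow_mul hr
  obtain hab | hab := lt_or_ge b a
  · obtain ⟨k, rfl⟩ := Nat.exists_eq_add_of_lt hab
    have hc : PowerSeries.constantCoeff (r' : PowerSeries ℂ) ≠ 0 := by
      rwa [Polynomial.constantCoeff_coe, Polynomial.coeff_zero_eq_eval_zero]
    have hX : polyToLaurent (Polynomial.X ^ b * r') ≠ 0 :=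
      (map_ne_zero_iff _ polyToLaurent_injective).2 hr
    have heq : polyToLaurent (Polynomial.X ^ (b + k + 1) * p') /
        polyToLaurent (Polynomial.X ^ b * r') = HahnSeries.ofPowerSeries ℤ ℂ
          (PowerSeries.X * (PowerSeries.X ^ k * (p' : PowerSeries ℂ) * (r' : PowerSeries ℂ)⁻¹)) := by
      rw [div_eq_iff hX, polyToLaurent_apply, polyToLaurent_apply, ← map_mul]
      congr 1
      push_cast
      linear_combination (-(PowerSeries.X : PowerSeries ℂ) ^ (b + k + 1) * (p' : PowerSeries ℂ)) *
        PowerSeries.mul_inv_cancel _ hc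
    have h0 := HahnSeries.ofPowerSeries_apply_coeff (Γ := ℤ)
      (PowerSeries.X * (PowerSeries.X ^ k * (p' : PowerSeries ℂ) * (r' : PowerSeries ℂ)⁻¹)) 0
    rw [heq]
    simpa using h0
  · exfalso
    obtain ⟨k, rfl⟩ := Nat.exists_eq_add_of_le hab
    -- `p'` is the product of the rational function and of `q ^ k * r'`, and tends to `0`
    have h1 := h.mul (tendsto_eval_nhdsGT_zero (.X ^ k * r'))
    rw [zero_mul] at h1
    refine hp' (tendsto_nhds_unique (tendsto_eval_nhdsGT_zero p') (h1.congr' ?_))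
    filter_upwards [eventually_eval_ne_zero hr, self_mem_nhdsWithin] with q hq hq0
    have hq0' : (q : ℂ) ≠ 0 := Complex.ofReal_ne_zero.2 (ne_of_gt hq0)
    simp only [Polynomial.eval_mul, Polynomial.eval_pow, Polynomial.eval_X] at hq ⊢
    have := right_ne_zero_of_mul hq
    rw [pow_add]
    field_simp

/-- If a sum of rational functions, possibly each with a pole at `0`, has a limit at `0`, then
this limit is the sum of the constant terms of their Laurent series. -/
theorem sum_coeff_zero_div_of_tendsto {ι : Type*} [Fintype ι] {p r : ι → Polynomial ℂ}
    (hr : ∀ i, r i ≠ 0) {l : ℂ}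
    (h : Tendsto (fun q : ℝ => ∑ i, (p i).eval (q : ℂ) / (r i).eval (q : ℂ)) (𝓝[>] 0) (𝓝 l)) :
    ∑ i, (polyToLaurent (p i) / polyToLaurent (r i)).coeff 0 = l := by
  classical
  let R : Polynomial ℂ := ∏ i, r i
  let N : Polynomial ℂ := ∑ i, p i * ∏ j ∈ Finset.univ.erase i, r j
  have hR : R ≠ 0 := Finset.prod_ne_zero_iff.2 fun i _ => hr i
  have hR' : polyToLaurent R ≠ 0 := (map_ne_zero_iff _ polyToLaurent_injective).2 hR
  have hN : polyToLaurent (N - .C l * R) / polyToLaurent R =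
      (∑ i, polyToLaurent (p i) / polyToLaurent (r i)) - HahnSeries.C l := by
    rw [div_eq_iff hR', sub_mul, map_sub, map_mul, polyToLaurent_C]
    congr 1
    rw [mul_comm]
    simp only [R, N, map_prod, map_sum, map_mul]
    exact (prod_mul_sum_div _ _ fun i =>
      (map_ne_zero_iff _ polyToLaurent_injective).2 (hr i)).symm
  have h0 : Tendsto (fun q : ℝ => (N - .C l * R).eval (q : ℂ) / R.eval (q : ℂ)) (𝓝[>] 0)
      (𝓝 0) := by
    have h1 := h.sub_const l
    rw [sub_self] at h1
    refine h1.congr' ?_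
    filter_upwards [eventually_all.2 fun i => eventually_eval_ne_zero (hr i)] with q hq
    have hRq : R.eval (q : ℂ) ≠ 0 := by
      simp only [R, Polynomial.eval_prod]
      exact Finset.prod_ne_zero_iff.2 fun i _ => hq i
    rw [eq_div_iff hRq, sub_mul, Polynomial.eval_sub, Polynomial.eval_mul, Polynomial.eval_C]
    congr 1
    rw [mul_comm]
    simp only [R, N, Polynomial.eval_prod, Polynomial.eval_finsetSum, Polynomial.eval_mul]
    exact prod_mul_sum_div _ _ hq
  have h2 := coeff_zero_div_eq_zero_of_tendsto_zero hR h0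
  rw [hN, HahnSeries.coeff_sub, HahnSeries.coeff_sum, HahnSeries.C_apply,
    HahnSeries.coeff_single_same, sub_eq_zero] at h2
  exact h2

/-- The product `∏ₖ (mₖ - (β · νₖ) q)`. -/
noncomputable def Term.linearDenom {n : ℕ} (F : Term n) (β : Fin n → ℤ) : Polynomial ℂ :=
  ∏ k, (.C (F.m k : ℂ) - .C ((β ⬝ᵥ F.ν k : ℤ) : ℂ) * .X)

theorem Term.Admissible.linearDenom_ne_zero {n : ℕ} {F : Term n} {β : Fin n → ℤ}
    (h : F.Admissible β) : F.linearDenom β ≠ 0 := by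
  refine Finset.prod_ne_zero_iff.2 fun k _ hk => h k ?_
  have h0 : F.m k = 0 := by
    have := congrArg (Polynomial.eval 0) hk
    simpa using this
  have h1 := congrArg (Polynomial.eval 1) hk
  rw [h0] at h1
  refine ⟨?_, h0⟩
  simpa using h1

theorem Term.algVol_eq_coeff {n : ℕ} (d : ℕ) (β : Fin n → ℤ) (F : Term n) :
    F.algVol d β = (polyToLaurent (.C (if F.h = d + 1 then F.L.evalOne else 0)) /
      polyToLaurent (F.linearDenom β)).coeff 0 := by
  rw [Term.algVol]
  split_ifs
  · simp only [Term.linearDenom, map_prod, map_sub, polyToLaurent_C, polyToLaurent_C_mul_X]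
  · simp

/-! ### The specialization `y = e ^ (s q β)`, `t = e ^ (-s)` -/

/-- The character `ν ↦ e ^ (r (β · ν))` of `ℤⁿ`. -/
noncomputable def expChar {n : ℕ} (β : Fin n → ℤ) (r : ℝ) : Multiplicative (Fin n → ℤ) →* ℂ where
  toFun ν := (Real.exp (r * (β ⬝ᵥ ν.toAdd : ℤ)) : ℝ)
  map_one' := by simp
  map_mul' a b := by
    rw [toAdd_mul, dotProduct_add, ← Complex.ofReal_mul, ← Real.exp_add]
    push_cast
    ring_nf

/-- The number `e ^ (-s)`, as a unit of `ℂ`. -/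
noncomputable def expUnit (s : ℝ) : ℂˣ :=
  Units.mk0 ((Real.exp (-s) : ℝ) : ℂ) (Complex.ofReal_ne_zero.2 (Real.exp_pos _).ne')

/-- The value of a Laurent polynomial at `y = e ^ (s q β)`, `t = e ^ (-s)`. -/
noncomputable def evalExp {n : ℕ} (β : Fin n → ℤ) (q s : ℝ) : LaurentPoly n →+* ℂ :=
  evalCharUnit (expChar β (s * q)) (expUnit s)

theorem expChar_mul_expUnit_zpow {n : ℕ} (β : Fin n → ℤ) (q s : ℝ) (ν : Fin n → ℤ) (m : ℤ) :
    expChar β (s * q) (.ofAdd ν) * (expUnit s : ℂ) ^ m =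
      (Real.exp (-(s * (m - q * (β ⬝ᵥ ν : ℤ)))) : ℝ) := by
  simp only [expChar, expUnit, MonoidHom.coe_mk, OneHom.coe_mk, Units.val_mk0, toAdd_ofAdd]
  rw [← Complex.ofReal_zpow, ← Complex.ofReal_mul, ← Real.rpow_intCast, ← Real.exp_mul,
    ← Real.exp_add]
  ring_nf

theorem tendsto_evalExp {n : ℕ} (β : Fin n → ℤ) (q : ℝ) (L : LaurentPoly n) :
    Tendsto (fun s => evalExp β q s L) (𝓝[>] 0) (𝓝 L.evalOne) := by
  have h : Continuous fun s => evalExp β q s L := by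
    simp only [evalExp, evalCharUnit_apply, expChar_mul_expUnit_zpow, Finsupp.sum]
    fun_prop
  have h1 := h.tendsto 0
  have h0 : evalExp β q 0 L = L.evalOne := by
    simp only [evalExp, evalCharUnit_apply, expChar_mul_expUnit_zpow, LaurentPoly.evalOne]
    simp
  rw [h0] at h1
  exact h1.mono_left nhdsWithin_le_nhds

theorem evalExp_denom {n : ℕ} (F : Term n) (β : Fin n → ℤ) (q s : ℝ) :
    evalExp β q s F.denom =
      ∏ k, (((1 - Real.exp (-(s * (F.m k - q * (β ⬝ᵥ F.ν k : ℤ))))) : ℝ) : ℂ) := by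
  simp only [Term.denom, map_prod, map_sub, map_one]
  refine Finset.prod_congr rfl fun k _ => ?_
  rw [evalExp, evalCharUnit_single, expChar_mul_expUnit_zpow]
  simp

theorem eval_linearDenom {n : ℕ} (F : Term n) (β : Fin n → ℤ) (q : ℝ) :
    (F.linearDenom β).eval (q : ℂ) =
      ∏ k, (((F.m k - q * (β ⬝ᵥ F.ν k : ℤ) : ℝ)) : ℂ) := by
  simp only [Term.linearDenom, Polynomial.eval_prod]
  refine Finset.prod_congr rfl fun k _ => ?_
  simp [mul_comm]

theorem evalExp_denom_ne_zero {n : ℕ} {F : Term n} {β : Fin n → ℤ} {q s : ℝ}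
    (hq : (F.linearDenom β).eval (q : ℂ) ≠ 0) (hs : 0 < s) : evalExp β q s F.denom ≠ 0 := by
  rw [eval_linearDenom, Finset.prod_ne_zero_iff] at hq
  rw [evalExp_denom, Finset.prod_ne_zero_iff]
  intro k hk
  have h := Complex.ofReal_ne_zero.1 (hq k hk)
  rw [Complex.ofReal_ne_zero, sub_ne_zero, ne_comm, Ne, Real.exp_eq_one_iff, neg_eq_zero]
  exact mul_ne_zero hs.ne' h

/-- Each factor `1 - y ^ ν t ^ m` of the denominator is equivalent to `s (m - (β · ν) q)`. -/
theorem tendsto_pow_mul_evalExp_div {n d : ℕ} {F : Term n} (hF : F.h ≤ d + 1) {β : Fin n → ℤ}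
    {q : ℝ} (hq : (F.linearDenom β).eval (q : ℂ) ≠ 0) :
    Tendsto (fun s : ℝ => (s : ℂ) ^ (d + 1) * (evalExp β q s F.L / evalExp β q s F.denom))
      (𝓝[>] 0) (𝓝 ((Polynomial.C (if F.h = d + 1 then F.L.evalOne else 0)).eval (q : ℂ) /
        (F.linearDenom β).eval (q : ℂ))) := by
  have h1 : Tendsto (fun s : ℝ => ∏ k, ((((1 - Real.exp (-(s * (F.m k - q * (β ⬝ᵥ F.ν k : ℤ))))) /
      s : ℝ)) : ℂ)) (𝓝[>] 0) (𝓝 ((F.linearDenom β).eval (q : ℂ))) := by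
    rw [eval_linearDenom]
    exact tendsto_finsetProd _ fun k _ =>
      (Complex.continuous_ofReal.tendsto _).comp (tendsto_one_sub_exp_div _)
  have h2 : Tendsto (fun s : ℝ => (s : ℂ) ^ (d + 1 - F.h)) (𝓝[>] 0)
      (𝓝 (if F.h = d + 1 then 1 else 0)) := by
    have h : Continuous fun s : ℝ => (s : ℂ) ^ (d + 1 - F.h) := by fun_prop
    have h' := h.tendsto 0
    have h0 : ((0 : ℝ) : ℂ) ^ (d + 1 - F.h) = if F.h = d + 1 then 1 else 0 := by
      split_ifs with hd
      · simp [hd]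
      · rw [Complex.ofReal_zero, zero_pow (by omega)]
    rw [h0] at h'
    exact h'.mono_left nhdsWithin_le_nhds
  have h3 := (h2.mul (tendsto_evalExp β q F.L)).div h1 hq
  have h4 : (if F.h = d + 1 then 1 else 0) * F.L.evalOne =
      (Polynomial.C (if F.h = d + 1 then F.L.evalOne else 0)).eval (q : ℂ) := by
    rw [Polynomial.eval_C]
    split_ifs <;> simp
  rw [h4] at h3
  refine h3.congr' ?_
  filter_upwards [self_mem_nhdsWithin] with s (hs : 0 < s)
  have hs' : (s : ℂ) ≠ 0 := Complex.ofReal_ne_zero.2 hs.ne'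
  have h5 := evalExp_denom_ne_zero hq hs
  simp only [Complex.ofReal_div, Finset.prod_div_distrib, ← evalExp_denom, Finset.prod_const,
    Finset.card_univ, Fintype.card_fin, Pi.div_apply]
  -- each factor of the denominator takes one power of `s`; for `h < d + 1` a positive power remains
  have h6 : (s : ℂ) ^ (d + 1) = (s : ℂ) ^ (d + 1 - F.h) * (s : ℂ) ^ F.h := by
    rw [← pow_add, Nat.sub_add_cancel hF]
  rw [h6]
  field_simp

/-- The coefficient of `t ^ k` in the Ehrhart series, as a Laurent polynomial; it is `0` for
`k < 0`. -/
noncomputable def ehrhartCoeff {n : ℕ} (P : Set (EuclideanSpace ℝ (Fin n))) (k : ℤ) :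
    AddMonoidAlgebra ℂ (Fin n → ℤ) :=
  if 0 ≤ k then ∑ᶠ α ∈ dilatePoints P k.toNat, AddMonoidAlgebra.single α 1 else 0

theorem IsIntegralPolytope.coeff_ehrhartSeries {n : ℕ} {P : Set (EuclideanSpace ℝ (Fin n))}
    (hP : IsIntegralPolytope P) (k : ℤ) :
    (HahnSeries.ofPowerSeries ℤ (RatFun n) (ehrhartSeries P)).coeff k =
      laurentToRatFun n (ehrhartCoeff P k) := by
  rw [ehrhartCoeff]
  split_ifs with hk
  · obtain ⟨k, rfl⟩ := Int.eq_ofNat_of_zero_le hk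
    rw [HahnSeries.ofPowerSeries_apply_coeff, ehrhartSeries, PowerSeries.coeff_mk, Int.toNat_natCast]
    change ∑ᶠ α ∈ dilatePoints P k, yPow α = _
    rw [finsum_mem_eq_finite_toFinset_sum _ (hP.finite_dilatePoints k),
      finsum_mem_eq_finite_toFinset_sum _ (hP.finite_dilatePoints k), map_sum]
    exact Finset.sum_congr rfl fun α _ => by simp [laurentToRatFun_single]
  · rw [map_zero, HahnSeries.ofPowerSeries_apply, HahnSeries.embDomain_of_notMem_range]
    rintro ⟨j, rfl⟩
    exact hk (by simp)

/-- At `y = e ^ (s q β)`, `t = e ^ (-s)` with `q` small, the Ehrhart series converges, and its value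
lies between two specializations at `y = 1`: if `|β · α| ≤ C k` on `k P`, each monomial of degree
`k` lies between `e ^ (-s (1 + C q) k)` and `e ^ (-s (1 - C q) k)`. -/
theorem IsIntegralPolytope.exists_hasSum_ehrhartCoeff {n d : ℕ}
    {P : Set (EuclideanSpace ℝ (Fin n))} (hP : IsIntegralPolytope P)
    (hd : Module.finrank ℝ (vectorSpan ℝ P) = d) {β : Fin n → ℤ} {C : ℝ} (hC : 0 ≤ C)
    (hβ : ∀ k : ℕ, ∀ α ∈ dilatePoints P k, |((β ⬝ᵥ α : ℤ) : ℝ)| ≤ C * k) {q s : ℝ} (hq : 0 ≤ q)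
    (hqC : C * q < 1) (hs : 0 < s) :
    ∃ S : ℝ, HasSum (fun k => evalChar (expChar β (s * q)) (ehrhartCoeff P k) * (expUnit s : ℂ) ^ k)
        (S : ℂ) ∧
      ∑' k, ((dilatePoints P k).ncard : ℝ) * Real.exp (-(s * (1 + C * q))) ^ k ≤ S ∧
      S ≤ ∑' k, ((dilatePoints P k).ncard : ℝ) * Real.exp (-(s * (1 - C * q))) ^ k := by
  have hlim := hP.tendsto_ncard_dilatePoints hd
  have hsum {l : ℝ} (hl : 0 < l) :
      Summable fun k => ((dilatePoints P k).ncard : ℝ) * Real.exp (-(s * l)) ^ k :=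
    summable_mul_pow_of_tendsto_div_pow hlim (Real.exp_pos _).le (by
      have : 0 < s * l := mul_pos hs hl
      simpa using this)
  have hCq : 0 ≤ C * q := mul_nonneg hC hq
  let A : ℕ → ℝ := fun k => ∑ α ∈ (hP.finite_dilatePoints k).toFinset,
    Real.exp (-(s * (k - q * (β ⬝ᵥ α : ℤ))))
  have hcard (k : ℕ) (x : ℝ) : ((dilatePoints P k).ncard : ℝ) * x =
      ∑ α ∈ (hP.finite_dilatePoints k).toFinset, x := by
    rw [Finset.sum_const, nsmul_eq_mul, ncard_eq_toFinset_card _ (hP.finite_dilatePoints k)]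
  have hbound (k : ℕ) (α) (hα : α ∈ (hP.finite_dilatePoints k).toFinset) :
      |q * ((β ⬝ᵥ α : ℤ) : ℝ)| ≤ C * q * k := by
    rw [abs_mul, abs_of_nonneg hq]
    calc q * |((β ⬝ᵥ α : ℤ) : ℝ)| ≤ q * (C * k) :=
          mul_le_mul_of_nonneg_left (hβ k α (by simpa using hα)) hq
      _ = C * q * k := by ring
  have hlow (k : ℕ) : ((dilatePoints P k).ncard : ℝ) * Real.exp (-(s * (1 + C * q))) ^ k ≤ A k := by
    rw [hcard]
    refine Finset.sum_le_sum fun α hα => ?_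
    rw [← Real.exp_nat_mul, Real.exp_le_exp]
    have := mul_le_mul_of_nonneg_left (abs_le.1 (hbound k α hα)).1 hs.le
    linarith
  have hupp (k : ℕ) : A k ≤ ((dilatePoints P k).ncard : ℝ) * Real.exp (-(s * (1 - C * q))) ^ k := by
    rw [hcard]
    refine Finset.sum_le_sum fun α hα => ?_
    rw [← Real.exp_nat_mul, Real.exp_le_exp]
    have := mul_le_mul_of_nonneg_left (abs_le.1 (hbound k α hα)).2 hs.le
    linarith
  have hA : Summable A := Summable.of_nonneg_of_le
    (fun k => Finset.sum_nonneg fun α _ => (Real.exp_pos _).le) hupp (hsum (by linarith))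
  refine ⟨∑' k, A k, ?_, (hsum (by linarith)).tsum_le_tsum hlow hA,
    hA.tsum_le_tsum hupp (hsum (by linarith))⟩
  rw [← (Nat.cast_injective (R := ℤ)).hasSum_iff]
  · refine ((Complex.hasSum_ofReal).2 hA.hasSum).congr_fun fun k => ?_
    simp only [Function.comp_apply, ehrhartCoeff, Nat.cast_nonneg, if_true, Int.toNat_natCast]
    rw [finsum_mem_eq_finite_toFinset_sum _ (hP.finite_dilatePoints k), map_sum, Finset.sum_mul,
      Complex.ofReal_sum]
    refine Finset.sum_congr rfl fun α _ => ?_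
    rw [evalChar_single, one_mul, expChar_mul_expUnit_zpow]
    simp
  · intro k hk
    have : ¬ 0 ≤ k := fun h => hk ⟨k.toNat, Int.toNat_of_nonneg h⟩
    simp [ehrhartCoeff, this]

/-- The leading coefficient at `s = 0` of the specialized Ehrhart series is
`∑ᵢ Lᵢ(1; 1) / ∏ₖ (mᵢₖ - (β · νᵢₖ) q)`, over the `i` with `hᵢ = d + 1`; it tends to
`d! vol P` as `q → 0`. -/
theorem IsIntegralPolytope.tendsto_sum_eval_div_linearDenom {n d : ℕ}
    {P : Set (EuclideanSpace ℝ (Fin n))} (hP : IsIntegralPolytope P)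
    (hd : Module.finrank ℝ (vectorSpan ℝ P) = d) {ι : Type*} [Fintype ι] {F : ι → Term n}
    (hh : ∀ i, (F i).h ≤ d + 1)
    (hF : HahnSeries.ofPowerSeries ℤ (RatFun n) (ehrhartSeries P) = ∑ i, (F i).toSeries)
    {β : Fin n → ℤ} (hβ : ∀ i, (F i).Admissible β) :
    Tendsto (fun q : ℝ => ∑ i,
        (Polynomial.C (if (F i).h = d + 1 then (F i).L.evalOne else 0)).eval (q : ℂ) /
          ((F i).linearDenom β).eval (q : ℂ)) (𝓝[>] 0)
      (𝓝 ((relVol P * d.factorial : ℝ) : ℂ)) := by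
  obtain ⟨C, hC, hCβ⟩ := hP.exists_abs_dotProduct_le β
  have hlim := hP.tendsto_ncard_dilatePoints hd
  set V := relVol P * d.factorial
  have hlow : Tendsto (fun q : ℝ => V / (1 + C * q) ^ (d + 1)) (𝓝[>] 0) (𝓝 V) := by
    have h : ContinuousAt (fun q : ℝ => V / (1 + C * q) ^ (d + 1)) 0 :=
      ContinuousAt.div (by fun_prop) (by fun_prop) (by simp)
    have h' := h.tendsto
    simp only [mul_zero, add_zero, one_pow, div_one] at h'
    exact h'.mono_left nhdsWithin_le_nhds
  have hupp : Tendsto (fun q : ℝ => V / (1 - C * q) ^ (d + 1)) (𝓝[>] 0) (𝓝 V) := by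
    have h : ContinuousAt (fun q : ℝ => V / (1 - C * q) ^ (d + 1)) 0 :=
      ContinuousAt.div (by fun_prop) (by fun_prop) (by simp)
    have h' := h.tendsto
    simp only [mul_zero, sub_zero, one_pow, div_one] at h'
    exact h'.mono_left nhdsWithin_le_nhds
  have hsmall : ∀ᶠ q : ℝ in 𝓝[>] 0, C * q < 1 := by
    have h : ContinuousAt (fun q : ℝ => C * q) 0 := by fun_prop
    have h' := h.tendsto
    rw [mul_zero] at h'
    exact (h'.mono_left nhdsWithin_le_nhds).eventually (gt_mem_nhds one_pos)
  -- the distance from the sum to the lower bound is at most the difference of the two bounds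
  refine ((Complex.continuous_ofReal.tendsto _).comp hlow).congr_dist
    (squeeze_zero' (.of_forall fun _ => dist_nonneg) ?_ ((hupp.sub hlow).trans (by rw [sub_self])))
  filter_upwards [hsmall, self_mem_nhdsWithin,
    eventually_all.2 fun i => eventually_eval_ne_zero (hβ i).linearDenom_ne_zero] with q hqC hq hqD
  replace hq : 0 < q := hq
  have hCq : 0 ≤ C * q := mul_nonneg hC hq.le
  have hElow := tendsto_pow_mul_tsum_exp hlim (l := 1 + C * q) (by linarith)
  have hEupp := tendsto_pow_mul_tsum_exp hlim (l := 1 - C * q) (by linarith)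
  have hG := tendsto_finsetSum Finset.univ fun i _ => tendsto_pow_mul_evalExp_div (hh i) (hqD i)
  refine le_of_tendsto_of_tendsto
    ((((Complex.continuous_ofReal.tendsto _).comp hElow)).dist hG) (hEupp.sub hElow) ?_
  filter_upwards [self_mem_nhdsWithin] with s hs
  replace hs : 0 < s := hs
  obtain ⟨S, hS, hSlow, hSupp⟩ := hP.exists_hasSum_ehrhartCoeff hd hC hCβ hq.le hqC hs
  have hSeq : (S : ℂ) = ∑ i, evalExp β q s (F i).L / evalExp β q s (F i).denom :=
    eq_sum_eval_of_toSeries_eq hβ hF hP.coeff_ehrhartSeries _ _ hS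
      fun i => evalExp_denom_ne_zero (hqD i) hs
  have hsp : 0 ≤ s ^ (d + 1) := by positivity
  rw [← Finset.mul_sum, ← hSeq, Function.comp_apply, ← Complex.ofReal_pow, ← Complex.ofReal_mul,
    Complex.dist_eq, ← Complex.ofReal_sub, Complex.norm_real, Real.norm_eq_abs, abs_sub_comm,
    ← mul_sub, ← mul_sub, abs_mul, abs_of_nonneg hsp, abs_of_nonneg (sub_nonneg.2 hSlow)]
  exact mul_le_mul_of_nonneg_left (sub_le_sub_right hSupp _) hsp

end EhrhartVolume

theorem mainTheorem1 {n d : ℕ} (P : Set (EuclideanSpace ℝ (Fin n)))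
    (hP : EhrhartVolume.IsIntegralPolytope P)
    (hd : Module.finrank ℝ (vectorSpan ℝ P) = d)
    {ι : Type*} [Fintype ι] (F : ι → EhrhartVolume.Term n)
    (hh : ∀ i, (F i).h ≤ d + 1)
    (hF : HahnSeries.ofPowerSeries ℤ (EhrhartVolume.RatFun n) (EhrhartVolume.ehrhartSeries P) =
      ∑ i, (F i).toSeries)
    (β : Fin n → ℤ) (hβ : ∀ i, (F i).Admissible β) :
    (EhrhartVolume.relVol P : ℂ) =
      1 / (d.factorial : ℂ) * ∑ i, (F i).algVol d β := by
  have h := EhrhartVolume.sum_coeff_zero_div_of_tendsto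
    (fun i => (hβ i).linearDenom_ne_zero) (hP.tendsto_sum_eval_div_linearDenom hd hh hF hβ)
  simp only [EhrhartVolume.Term.algVol_eq_coeff, h]
  have : (d.factorial : ℂ) ≠ 0 := by exact_mod_cast d.factorial_ne_zero
  push_cast
  field_simp
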